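/- Let $\mathbb S\subset\mathbb R$ be finite and let $G=(G(x,z))_{x,z\in\mathbb S}$ be a transition rate matrix, i.e. $G(x,z)\ge 0$ for $z\ne x$ and $G(x,x)=-\sum_{z\neq x}G(x,z)$. Let $Y$ be a continuous-time Markov chain on $\mathbb S$ with rate matrix $G$ and right-continuous paths. Write $\overline Y$ and $\underline Y$ for the running maximum and minimum of $Y$; when initial values $Y_0=x$, $\overline Y_0=x$, $\underline Y_0=y$ (with $y\le x$) are prescribed, $\overline Y_t=x\vee\sup_{0\le u\le t}Y_u$ and $\underline Y_t=y\wedge\inf_{0\le u\le t}Y_u$, and $\mathbb E_{x,y}$ denotes the corresponding expectation. With $\inf\emptyset=\infty$, put $$T_U=\inf\{t>0:Y_t\notin U\}\ (U\subseteq\mathbb R),\quad T_r^+=T_{(-\infty,r]},\quad T_\ell^-=T_{(\ell,\infty)},$$ $$\tau_a=\inf\{t\ge 0:\overline Y_t-Y_t\ge a\},\quad \widehat\tau_b=\inf\{t\ge 0:Y_t-\underline Y_t\ge b\}.$$ Fix $q\in\mathbb C$ with $\Re q>0$. For $f:\mathbb S\to\mathbb C$, $g:\mathbb S\times\mathbb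 S\to\mathbb C$ and real $\ell<r$ define $$P_U(q,x;f)=\mathbb E\big[e^{-qT_U}\mathbf 1_{\{T_U<\infty\}}f(Y_{T_U})\,\big|\,Y_0=x\big],\qquad A(q,x,y)=\mathbb E_{x,y}\big[e^{-q\tau_a}\mathbf 1_{\{\tau_a<\widehat\tau_b\}}f(Y_{\tau_a})\big],$$ $$R_{(\ell,r]}(q,x,y;g)=\mathbb E\big[e^{-qT_r^+}\mathbf 1_{\{T_\ell^->T_r^+\}}\,g(Y_{T_r^+},\underline Y_{T_r^+})\,\big|\,Y_0=x,\ \underline Y_0=y\big].$$ (i) Suppose $b\ge a>0$. For every $f:\mathbb S\to\mathbb C$, $x\in\mathbb S$ and $y\in\mathbb S\cap(x-a,x]$, $$A(q,x,y)=P_{(x-a,x]}\big(q,x;f(\cdot)\mathbf 1_{\{\cdot\le x-a\}}\big)+\sum_{\substack{z\in\mathbb S\cap(x,\,y+b)\\ w\in\mathbb S\cap((x-a)\vee(z-b),\,y]}}R_{(x-a,x]}\big(q,x,y;\mathbf 1_{\{\cdot=z,\ \tilde\cdot=w\}}\big)\,A(q,z,w),$$ where $\mathbf 1_{\{\cdot=z,\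 \tilde\cdot=w\}}$ is the function $g(s,m)=\mathbf 1_{\{s=z,\ m=w\}}$. (ii) For all real $\ell<r$, every $g:\mathbb S\times\mathbb S\to\mathbb C$ and all $x,y\in\mathbb S$ with $x\ge y$, $$\begin{cases} q\,R_{(\ell,r]}(q,x,y;g)-\displaystyle\sum_{z\in\mathbb S}G(x,z)\,R_{(\ell,r]}(q,z,y\wedge z;g)=0, & x\in(\ell,r],\\[1ex] R_{(\ell,r]}(q,x,y;g)=g(x,y)\,\mathbf 1_{\{x>r\}}, & x\notin(\ell,r].\end{cases}$$ -/

import Mathlib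

open scoped NNReal ENNReal

noncomputable section

namespace CTMC

/-- Transition rate matrix on the finite state space `S ⊆ ℝ`: nonnegative off-diagonal entries and
rows summing to zero. -/
structure IsRateMatrix {S : Finset ℝ} (G : Matrix S S ℝ) : Prop where
  offDiag_nonneg : ∀ x y : S, y ≠ x → 0 ≤ G x y
  diag_eq : ∀ x : S, G x x = -∑ y ∈ Finset.univ.erase x, G x y

/-- `Y` is, under the family of laws `μ x` (`x` the starting state), a continuous-time Markov chain
on `S` with rate matrix `G`: its paths are right-continuous (for the topology of `S`, which is
discrete) and its finite-dimensional distributions are those given by the transition matrices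
`p(t) = exp (t G)`, started from `x` at time `0`. The case `n = 0` says `μ x (Y 0 = x) = 1`. -/
structure IsCTMC {Ω : Type*} [MeasurableSpace Ω] {S : Finset ℝ} (G : Matrix S S ℝ)
    (μ : S → MeasureTheory.Measure Ω) (Y : ℝ≥0 → Ω → S) : Prop where
  prob : ∀ x, MeasureTheory.IsProbabilityMeasure (μ x)
  measurable : ∀ t, Measurable (Y t)
  rightCont : ∀ ω t, ContinuousWithinAt (fun s => Y s ω) (Set.Ici t) t
  fdd : ∀ (x : S) (n : ℕ) (t : ℕ → ℝ≥0) (z : ℕ → S), Monotone t → t 0 = 0 → z 0 = x →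
    μ x {ω | ∀ i ≤ n, Y (t i) ω = z i} =
      ENNReal.ofReal (∏ i ∈ Finset.range n,
        NormedSpace.exp (((t (i + 1) : ℝ) - (t i : ℝ)) • G) (z i) (z (i + 1)))

variable {S : Finset ℝ}

/-- Running maximum at time `t` of the path `p` with initial maximum `m`: the largest element of
`{m} ∪ {p u : 0 ≤ u ≤ t}`. -/
def runMax (m : S) (p : ℝ≥0 → S) (t : ℝ≥0) : S :=
  (Set.toFinite (insert m (p '' Set.Iic t))).toFinset.max' ⟨m, by simp⟩

/-- Running minimum at time `t` of the path `p` with initial minimum `m`: the smallest element of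
`{m} ∪ {p u : 0 ≤ u ≤ t}`. -/
def runMin (m : S) (p : ℝ≥0 → S) (t : ℝ≥0) : S :=
  (Set.toFinite (insert m (p '' Set.Iic t))).toFinset.min' ⟨m, by simp⟩

theorem coe_runMax (m : S) (p : ℝ≥0 → S) (t : ℝ≥0) :
    (runMax m p t : ℝ) = max (m : ℝ) (⨆ u : Set.Iic t, (p u : ℝ)) := by
  have hmem := Finset.max'_mem (Set.toFinite (insert m (p '' Set.Iic t))).toFinset ⟨m, by simp⟩
  have hle := Finset.le_max' (Set.toFinite (insert m (p '' Set.Iic t))).toFinset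
  rw [Set.Finite.mem_toFinset] at hmem
  change runMax m p t ∈ _ at hmem
  have hm : (m : ℝ) ≤ runMax m p t := hle m (by simp)
  have hp : ∀ u : Set.Iic t, (p u : ℝ) ≤ runMax m p t := fun u =>
    hle (p u) ((Set.Finite.mem_toFinset _).2 (Or.inr ⟨u, u.2, rfl⟩))
  have : Nonempty (Set.Iic t) := ⟨⟨t, Set.mem_Iic.2 le_rfl⟩⟩
  refine le_antisymm ?_ (max_le hm (ciSup_le hp))
  rcases hmem with h | ⟨u, hu, h⟩
  · rw [h]; exact le_max_left _ _
  · rw [← h] at hp ⊢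
    exact le_max_of_le_right (le_ciSup (f := fun u : Set.Iic t => (p u : ℝ))
      ⟨_, Set.forall_mem_range.2 hp⟩ ⟨u, hu⟩)

theorem coe_runMin (m : S) (p : ℝ≥0 → S) (t : ℝ≥0) :
    (runMin m p t : ℝ) = min (m : ℝ) (⨅ u : Set.Iic t, (p u : ℝ)) := by
  have hmem := Finset.min'_mem (Set.toFinite (insert m (p '' Set.Iic t))).toFinset ⟨m, by simp⟩
  have hle := Finset.min'_le (Set.toFinite (insert m (p '' Set.Iic t))).toFinset
  rw [Set.Finite.mem_toFinset] at hmem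
  change runMin m p t ∈ _ at hmem
  have hm : (runMin m p t : ℝ) ≤ m := hle m (by simp)
  have hp : ∀ u : Set.Iic t, (runMin m p t : ℝ) ≤ p u := fun u =>
    hle (p u) ((Set.Finite.mem_toFinset _).2 (Or.inr ⟨u, u.2, rfl⟩))
  have : Nonempty (Set.Iic t) := ⟨⟨t, Set.mem_Iic.2 le_rfl⟩⟩
  refine le_antisymm (le_min hm (le_ciInf hp)) ?_
  rcases hmem with h | ⟨u, hu, h⟩
  · rw [h]; exact min_le_left _ _
  · rw [← h] at hp ⊢
    exact min_le_of_right_le (ciInf_le (f := fun u : Set.Iic t => (p u : ℝ))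
      ⟨_, Set.forall_mem_range.2 hp⟩ ⟨u, hu⟩)

/-- First passage time `inf {t > 0 : p t ∉ U}`, with `inf ∅ = ∞`. -/
def exitTime (U : Set ℝ) (p : ℝ≥0 → S) : ℝ≥0∞ :=
  ⨅ (t : ℝ≥0) (_ : 0 < t ∧ (p t : ℝ) ∉ U), (t : ℝ≥0∞)

/-- Drawdown time `inf {t ≥ 0 : max_t - p t ≥ a}`, the running maximum starting from `m`. -/
def drawdownTime (a : ℝ) (m : S) (p : ℝ≥0 → S) : ℝ≥0∞ :=
  ⨅ (t : ℝ≥0) (_ : a ≤ (runMax m p t : ℝ) - (p t : ℝ)), (t : ℝ≥0∞)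

/-- Drawup time `inf {t ≥ 0 : p t - min_t ≥ b}`, the running minimum starting from `m`. -/
def drawupTime (b : ℝ) (m : S) (p : ℝ≥0 → S) : ℝ≥0∞ :=
  ⨅ (t : ℝ≥0) (_ : b ≤ (p t : ℝ) - (runMin m p t : ℝ)), (t : ℝ≥0∞)

open Classical in
/-- `P_U(q, x; f) = E_x [e^{-q T_U} 1{T_U < ∞} f(Y_{T_U})]`. -/
def exitP {Ω : Type*} [MeasurableSpace Ω] (μ : S → MeasureTheory.Measure Ω) (Y : ℝ≥0 → Ω → S)
    (U : Set ℝ) (q : ℂ) (x : S) (f : S → ℂ) : ℂ :=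
  ∫ ω, (let T := exitTime U (fun t => Y t ω)
    if T < ∞ then Complex.exp (-q * (T.toReal : ℂ)) * f (Y T.toNNReal ω) else 0) ∂(μ x)

open Classical in
/-- `A(q, x, y) = E_{x,y} [e^{-q τ_a} 1{τ_a < τ̂_b} f(Y_{τ_a})]`, where the chain and its running
maximum start at `x` and its running minimum starts at `y`. -/
def drawdownA {Ω : Type*} [MeasurableSpace Ω] (μ : S → MeasureTheory.Measure Ω) (Y : ℝ≥0 → Ω → S)
    (a b : ℝ) (f : S → ℂ) (q : ℂ) (x y : S) : ℂ :=
  ∫ ω, (let τ := drawdownTime a x (fun t => Y t ω)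
    if τ < drawupTime b y (fun t => Y t ω) then
      Complex.exp (-q * (τ.toReal : ℂ)) * f (Y τ.toNNReal ω) else 0) ∂(μ x)

open Classical in
/-- `R_{(ℓ,r]}(q, x, y; g) = E [e^{-q T_r⁺} 1{T_ℓ⁻ > T_r⁺} g(Y_{T_r⁺}, min_{T_r⁺})]`, where the chain
starts at `x`, its running minimum starts at `y`, `T_r⁺` is the first exit from `(-∞, r]` and
`T_ℓ⁻` is the first exit from `(ℓ, ∞)`. -/
def upExitR {Ω : Type*} [MeasurableSpace Ω] (μ : S → MeasureTheory.Measure Ω) (Y : ℝ≥0 → Ω → S)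
    (ℓ r : ℝ) (q : ℂ) (x y : S) (g : S → S → ℂ) : ℂ :=
  ∫ ω, (let T := exitTime (Set.Iic r) (fun t => Y t ω)
    if T < exitTime (Set.Ioi ℓ) (fun t => Y t ω) then
      Complex.exp (-q * (T.toReal : ℂ)) *
        g (Y T.toNNReal ω) (runMin y (fun t => Y t ω) T.toNNReal) else 0) ∂(μ x)

end CTMC

end

/-!
Observe the chain on the time grid `h ℕ` and consider the expected discounted payoff at the first
entrance of the triple (position, running maximum, running minimum) into a set `D`. The Markov
property at time `h` gives a Bellman equation for it outside `D`; dividing by `h` and letting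
`h → 0` shows that the payoff `u` at the first entrance in continuous time satisfies
`(q - G) u = 0` outside `D`, where `G` acts by moving the position and updating the extrema.
Exit problems, drawdowns and drawups all have this form, and (ii) is a special case.

Both sides of (i), as functions of the initial position and minimum, satisfy this equation as long
as the position has not left `(x - a, x]`: within this window the drawdown and the drawup stay
below `a ≤ b`. On exit both sides agree: below the window the drawdown has occurred, and above it
the running maximum restarts at the current position, so that the payoff is again a value of
`A`. As `Re q > 0`, the maximum principle for `q - G` gives (i).
-/

namespace CTMC

open Filter Topology MeasureTheory

/-! ### First entrance of a path into a set -/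

section Entrance

variable {ι E : Type*} [LinearOrder ι] {D : Set E} {c : ι → E → ℂ} {X : ι → E}

open Classical in
/-- The payoff `c T (X T)` at the first entrance time `T` of the path `X` into `D`, and `0` if there
is no such time. It serves both for continuous time and for the time steps of a grid. -/
noncomputable def entrancePayoff (D : Set E) (c : ι → E → ℂ) (X : ι → E) : ℂ :=
  if h : ∃ T, IsLeast {t | X t ∈ D} T then c h.choose (X h.choose) else 0

theorem entrancePayoff_of_isLeast {T : ι} (hT : IsLeast {t | X t ∈ D} T) :
    entrancePayoff D c X = c T (X T) := by
  have h : ∃ T, IsLeast {t | X t ∈ D} T := ⟨T, hT⟩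
  rw [entrancePayoff, dif_pos h, h.choose_spec.unique hT]

theorem entrancePayoff_of_forall_notMem (h : ∀ t, X t ∉ D) : entrancePayoff D c X = 0 :=
  dif_neg fun ⟨T, hT⟩ => h T hT.1

theorem entrancePayoff_const_mul (γ : ℂ) :
    entrancePayoff D (fun t e => γ * c t e) X = γ * entrancePayoff D c X := by
  unfold entrancePayoff
  split_ifs
  · rfl
  · rw [mul_zero]

theorem norm_entrancePayoff_le {C : ℝ} (hC : 0 ≤ C) (hc : ∀ t e, ‖c t e‖ ≤ C) :
    ‖entrancePayoff D c X‖ ≤ C := by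
  unfold entrancePayoff
  split_ifs
  · exact hc _ _
  · rwa [norm_zero]

theorem entrancePayoff_succ {c : ℕ → E → ℂ} {X : ℕ → E} (h0 : X 0 ∉ D) :
    entrancePayoff D c X = entrancePayoff D (fun k => c (k + 1)) fun k => X (k + 1) := by
  by_cases h : ∃ k, X (k + 1) ∈ D
  · have hT := isLeast_csInf (s := {k | X (k + 1) ∈ D}) h
    rw [entrancePayoff_of_isLeast hT]
    refine entrancePayoff_of_isLeast ⟨hT.1, fun k hk => ?_⟩
    cases k with
    | zero => exact absurd hk h0
    | succ k => exact Nat.succ_le_succ (hT.2 hk)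
  · rw [not_exists] at h
    rw [entrancePayoff_of_forall_notMem h,
      entrancePayoff_of_forall_notMem (Nat.rec h0 fun k _ => h k)]

theorem measurable_entrancePayoff {Ω : Type*} [MeasurableSpace Ω] [MeasurableSpace E]
    [DiscreteMeasurableSpace E] (D : Set E) (c : ℕ → E → ℂ) {X : ℕ → Ω → E}
    (hX : ∀ k, Measurable (X k)) : Measurable fun ω => entrancePayoff D c fun k => X k ω := by
  classical
  let stops (k : ℕ) (ω : Ω) : Prop := X k ω ∈ D ∨ ∀ j, X j ω ∉ D
  have exists_stops (ω : Ω) : ∃ k, stops k ω := by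
    by_cases h : ∃ k, X k ω ∈ D
    · exact h.imp fun _ => Or.inl
    · exact ⟨0, Or.inr (not_exists.1 h)⟩
  have measurableSet_avoids : MeasurableSet {ω | ∀ j, X j ω ∉ D} := by
    rw [Set.ofPred_forall]
    exact .iInter fun j => (hX j .of_discrete).compl
  have measurableSet_stops (k : ℕ) : MeasurableSet {ω | stops k ω} :=
    (hX k .of_discrete).union measurableSet_avoids
  have measurable_payoff (k : ℕ) : Measurable fun ω => D.indicator (c k) (X k ω) :=
    (Measurable.of_discrete (f := D.indicator (c k))).comp (hX k)
  convert Measurable.find measurable_payoff measurableSet_stops exists_stops using 2 with ω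
  by_cases h : ∃ k, X k ω ∈ D
  · have hT := isLeast_csInf (s := {k | X k ω ∈ D}) h
    have find_eq : Nat.find (exists_stops ω) = sInf {k | X k ω ∈ D} := (Nat.find_eq_iff _).2
      ⟨Or.inl hT.1, fun k hk h' => h'.elim (fun h' => hk.not_ge (hT.2 h')) fun h' => h' _ hT.1⟩
    rw [find_eq, entrancePayoff_of_isLeast hT, Set.indicator_of_mem (s := D) hT.1]
  · rw [not_exists] at h
    rw [entrancePayoff_of_forall_notMem h, Set.indicator_of_notMem (h _)]

end Entrance

section RightConstant

variable {E : Type*} {A B D : Set E} {X : ℝ≥0 → E} {T : ℝ≥0}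

/-- The path `X` stays for a while in each state it reaches, that is, it is right-continuous for
the discrete topology of `E`. -/
def RightConstant (X : ℝ≥0 → E) : Prop := ∀ t, ∀ᶠ u in 𝓝[≥] t, X u = X t

theorem rightConstant_of_continuousWithinAt [TopologicalSpace E] [DiscreteTopology E]
    (hX : ∀ t, ContinuousWithinAt X (Set.Ici t) t) : RightConstant X := fun t =>
  (hX t).tendsto (mem_nhds_discrete.2 (Set.mem_singleton (X t)))

theorem RightConstant.exists_isLeast (hX : RightConstant X) (h : ∃ t, X t ∈ D) :
    ∃ T, IsLeast {t | X t ∈ D} T := by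
  have hT : IsGLB {t | X t ∈ D} (sInf {t | X t ∈ D}) := isGLB_csInf h (OrderBot.bddBelow _)
  obtain ⟨u, hu, hTu⟩ := ((hT.frequently_mem h).and_eventually (hX _)).exists
  exact ⟨_, show X _ ∈ D from hTu ▸ hu, hT.1⟩

theorem tendsto_ceil_div_mul_nhdsGE (T : ℝ≥0) :
    Tendsto (fun h : ℝ≥0 => ⌈T / h⌉₊ * h) (𝓝[>] 0) (𝓝[≥] T) := by
  have hlower : ∀ᶠ h : ℝ≥0 in 𝓝[>] 0, T ≤ ⌈T / h⌉₊ * h := by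
    filter_upwards [self_mem_nhdsWithin] with h hh
    exact (div_le_iff₀ hh).1 (Nat.le_ceil _)
  have hupper : ∀ᶠ h : ℝ≥0 in 𝓝[>] 0, ⌈T / h⌉₊ * h ≤ T + h := by
    filter_upwards [self_mem_nhdsWithin] with h hh
    calc ⌈T / h⌉₊ * h ≤ (T / h + 1) * h := by gcongr; exact (Nat.ceil_lt_add_one zero_le).le
      _ = T + h := by rw [add_mul, one_mul, div_mul_cancel₀ _ (ne_of_gt hh)]
  have hlim : Tendsto (fun h : ℝ≥0 => T + h) (𝓝[>] 0) (𝓝 T) := by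
    have hadd : Continuous fun h : ℝ≥0 => T + h := by fun_prop
    simpa only [add_zero] using (hadd.tendsto 0).mono_left nhdsWithin_le_nhds
  exact tendsto_nhdsWithin_iff.2
    ⟨tendsto_of_tendsto_of_tendsto_of_le_of_le' tendsto_const_nhds hlim hlower hupper, hlower⟩

theorem RightConstant.eventually_isLeast_grid (hX : RightConstant X)
    (hT : IsLeast {t | X t ∈ D} T) :
    ∀ᶠ h : ℝ≥0 in 𝓝[>] 0,
      X (⌈T / h⌉₊ * h) = X T ∧ IsLeast {k : ℕ | X (k * h) ∈ D} ⌈T / h⌉₊ := by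
  filter_upwards [(tendsto_ceil_div_mul_nhdsGE T).eventually (hX T), self_mem_nhdsWithin]
    with h hXT hh
  exact ⟨hXT, show X _ ∈ D from hXT ▸ hT.1,
    fun k hk => Nat.ceil_le.2 ((div_le_iff₀ hh).2 (hT.2 hk))⟩

theorem RightConstant.tendsto_entrancePayoff_grid (hX : RightConstant X) {c : ℝ≥0 → E → ℂ}
    (hc : ∀ e, Continuous fun t => c t e) :
    Tendsto (fun h : ℝ≥0 => entrancePayoff D (fun (k : ℕ) e => c (k * h) e) fun k => X (k * h))
      (𝓝[>] 0) (𝓝 (entrancePayoff D c X)) := by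
  by_cases h : ∃ t, X t ∈ D
  · obtain ⟨T, hT⟩ := hX.exists_isLeast h
    rw [entrancePayoff_of_isLeast hT]
    refine (((hc (X T)).tendsto T).comp
      ((tendsto_ceil_div_mul_nhdsGE T).mono_right nhdsWithin_le_nhds)).congr' ?_
    filter_upwards [hX.eventually_isLeast_grid hT] with h hh
    rw [entrancePayoff_of_isLeast hh.2, hh.1, Function.comp_apply]
  · rw [not_exists] at h
    simp only [entrancePayoff_of_forall_notMem fun _ => h _, tendsto_const_nhds]

/-- A fine grid sees each of the finitely many states of the path immediately after its first
visit. -/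
theorem RightConstant.eventually_image_grid [Finite E] (hX : RightConstant X) :
    ∀ᶠ h : ℝ≥0 in 𝓝[>] 0, ∀ k : ℕ,
      X '' Set.Iic (k * h) = (fun j : ℕ => X (j * h)) '' Set.Iic k := by
  have hvisit : ∀ᶠ h : ℝ≥0 in 𝓝[>] 0, ∀ (e : E) (k : ℕ), ∀ u ≤ k * h, X u = e →
      ∃ j ≤ k, X (j * h) = e := by
    refine eventually_all.2 fun e => ?_
    by_cases he : ∃ u, X u = e
    · obtain ⟨T, hT⟩ := hX.exists_isLeast (D := {e}) he
      filter_upwards [hX.eventually_isLeast_grid hT, self_mem_nhdsWithin] with h hTh hh k u hu hue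
      exact ⟨⌈T / h⌉₊, Nat.ceil_le.2 ((div_le_iff₀ hh).2 ((hT.2 hue).trans hu)), hTh.2.1⟩
    · exact .of_forall fun h k u _ hue => absurd ⟨u, hue⟩ he
  filter_upwards [hvisit] with h hh k
  refine Set.Subset.antisymm (Set.image_subset_iff.2 fun u hu => hh _ k u hu rfl) ?_
  rintro _ ⟨j, hj, rfl⟩
  exact ⟨j * h, mul_le_mul_left (Nat.cast_le.2 hj) h, rfl⟩

/-- The first time at which the path `X` is in `A`, and `∞` if there is none. -/
noncomputable def entranceTime (A : Set E) (X : ℝ≥0 → E) : ℝ≥0∞ :=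
  ⨅ (t : ℝ≥0) (_ : X t ∈ A), (t : ℝ≥0∞)

theorem entranceTime_of_isLeast (hT : IsLeast {t | X t ∈ A} T) : entranceTime A X = T :=
  le_antisymm (iInf₂_le T hT.1) (le_iInf₂ fun _ ht => ENNReal.coe_le_coe.2 (hT.2 ht))

theorem entranceTime_of_forall_notMem (h : ∀ t, X t ∉ A) : entranceTime A X = ∞ :=
  top_le_iff.1 (le_iInf₂ fun t ht => absurd ht (h t))

theorem RightConstant.coe_lt_entranceTime (hX : RightConstant X) (h : ∀ t ≤ T, X t ∉ A) :
    T < entranceTime A X := by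
  by_cases hA : ∃ t, X t ∈ A
  · obtain ⟨T', hT'⟩ := hX.exists_isLeast hA
    rw [entranceTime_of_isLeast hT', ENNReal.coe_lt_coe, ← not_le]
    exact fun hle => h T' hle hT'.1
  · rw [entranceTime_of_forall_notMem (not_exists.1 hA)]
    exact ENNReal.coe_lt_top

open Classical in
theorem RightConstant.entrancePayoff_union (hX : RightConstant X) (A B : Set E)
    (c : ℝ≥0 → E → ℂ) :
    entrancePayoff (A ∪ B) (fun t => Bᶜ.indicator (c t)) X =
      if entranceTime A X < entranceTime B X then
        c (entranceTime A X).toNNReal (X (entranceTime A X).toNNReal)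
      else 0 := by
  by_cases h : ∃ t, X t ∈ A ∪ B
  · obtain ⟨T, hT⟩ := hX.exists_isLeast h
    have notMem_of_lt : ∀ t < T, X t ∉ A ∪ B := fun t ht hmem => ht.not_ge (hT.2 hmem)
    rw [entrancePayoff_of_isLeast hT]
    by_cases hB : X T ∈ B
    · have hle : entranceTime B X ≤ entranceTime A X :=
        (iInf₂_le T hB).trans (le_iInf₂ fun t ht => ENNReal.coe_le_coe.2 (hT.2 (Or.inl ht)))
      rw [Set.indicator_of_notMem (not_not.2 hB), if_neg hle.not_gt]
    · have hA : IsLeast {t | X t ∈ A} T :=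
        ⟨hT.1.resolve_right hB, fun t ht => hT.2 (Or.inl ht)⟩
      have hlt : T < entranceTime B X := hX.coe_lt_entranceTime fun t ht => by
        rcases ht.lt_or_eq with ht | rfl
        · exact fun hmem => notMem_of_lt t ht (Or.inr hmem)
        · exact hB
      rw [Set.indicator_of_mem hB, entranceTime_of_isLeast hA, if_pos hlt, ENNReal.toNNReal_coe]
  · simp only [not_exists, Set.mem_union, not_or] at h
    rw [entrancePayoff_of_forall_notMem fun t ht => ht.elim (h t).1 (h t).2,
      entranceTime_of_forall_notMem fun t => (h t).1, if_neg (not_lt.2 le_top)]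

end RightConstant

/-! ### The chain with its running maximum and minimum -/

/-- The state reached from `e` through successive moves along `ξ 0, ξ 1, …`. -/
def orbit {E α : Type*} (step : E → α → E) (e : E) (ξ : ℕ → α) : ℕ → E
  | 0 => e
  | k + 1 => step (orbit step e ξ k) (ξ k)

theorem orbit_succ' {E α : Type*} (step : E → α → E) (e : E) (ξ : ℕ → α) (k : ℕ) :
    orbit step e ξ (k + 1) = orbit step (step e (ξ 0)) (fun j => ξ (j + 1)) k := by
  induction k with
  | zero => rfl
  | succ k ih => exact congrArg (step · (ξ (k + 1))) ih

section RunningExtrema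

variable {S : Finset ℝ} {M m : S} {p : ℝ≥0 → S} {t u : ℝ≥0}

theorem isGreatest_runMax (M : S) (p : ℝ≥0 → S) (t : ℝ≥0) :
    IsGreatest (insert M (p '' Set.Iic t)) (runMax M p t) := by
  have h := Finset.isGreatest_max' (Set.toFinite (insert M (p '' Set.Iic t))).toFinset
    ⟨M, by simp⟩
  rwa [Set.Finite.coe_toFinset] at h

theorem isLeast_runMin (m : S) (p : ℝ≥0 → S) (t : ℝ≥0) :
    IsLeast (insert m (p '' Set.Iic t)) (runMin m p t) := by
  have h := Finset.isLeast_min' (Set.toFinite (insert m (p '' Set.Iic t))).toFinset ⟨m, by simp⟩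
  rwa [Set.Finite.coe_toFinset] at h

/-- Position, running maximum and running minimum of the path `p` at time `t`, the extrema starting
from `M` and `m`. -/
noncomputable def stateAt (M m : S) (p : ℝ≥0 → S) (t : ℝ≥0) : S × S × S :=
  (p t, runMax M p t, runMin m p t)

/-- The triple (position, running maximum, running minimum) after a move of the position to `z`. -/
def moveTo (e : S × S × S) (z : S) : S × S × S := (z, e.2.1 ⊔ z, e.2.2 ⊓ z)

theorem moveTo_self {e : S × S × S} (hmax : e.1 ≤ e.2.1) (hmin : e.2.2 ≤ e.1) :
    moveTo e e.1 = e := by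
  rw [moveTo, sup_eq_left.2 hmax, inf_eq_left.2 hmin]

theorem stateAt_zero (hM : p 0 ≤ M) (hm : m ≤ p 0) : stateAt M m p 0 = (p 0, M, m) := by
  have himage : p '' Set.Iic 0 = {p 0} := by rw [← bot_eq_zero, Set.Iic_bot, Set.image_singleton]
  have hmax := isGreatest_runMax M p 0
  have hmin := isLeast_runMin m p 0
  rw [himage] at hmax hmin
  rw [stateAt, hmax.unique isGreatest_pair, hmin.unique isLeast_pair, sup_eq_left.2 hM,
    inf_eq_left.2 hm]

theorem stateAt_eq_moveTo (h : p '' Set.Iic u = insert (p u) (p '' Set.Iic t)) :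
    stateAt M m p u = moveTo (stateAt M m p t) (p u) := by
  have hmax := isGreatest_runMax M p u
  have hmin := isLeast_runMin m p u
  rw [h, Set.insert_comm] at hmax hmin
  rw [moveTo, stateAt, hmax.unique ((isGreatest_runMax M p t).insert _),
    hmin.unique ((isLeast_runMin m p t).insert _), sup_comm, inf_comm]
  rfl

theorem RightConstant.rightConstant_stateAt (hp : RightConstant p) (M m : S) :
    RightConstant (stateAt M m p) := fun t => by
  obtain ⟨v, hv, hpv⟩ := mem_nhdsGE_iff_exists_Ico_subset.1 (hp t)
  have stateAt_eq : ∀ u ∈ Set.Ico t v, stateAt M m p u = moveTo (stateAt M m p t) (p t) := by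
    intro u hu
    rw [← hpv hu]
    refine stateAt_eq_moveTo (Set.Subset.antisymm (Set.image_subset_iff.2 fun w hw => ?_)
      (Set.insert_subset ⟨u, Set.self_mem_Iic, rfl⟩ (Set.image_mono (Set.Iic_subset_Iic.2 hu.1))))
    rcases le_total w t with hwt | htw
    · exact Or.inr ⟨w, hwt, rfl⟩
    · exact Or.inl ((hpv ⟨htw, hw.trans_lt hu.2⟩).trans (hpv hu).symm)
  filter_upwards [Ico_mem_nhdsGE hv] with u hu
  exact (stateAt_eq u hu).trans (stateAt_eq t ⟨le_rfl, hv⟩).symm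

theorem RightConstant.eventually_orbit_eq_stateAt (hp : RightConstant p) (hM : p 0 ≤ M)
    (hm : m ≤ p 0) :
    ∀ᶠ h : ℝ≥0 in 𝓝[>] 0, ∀ k : ℕ,
      orbit moveTo (p 0, M, m) (fun j : ℕ => p ((j + 1 : ℕ) * h)) k = stateAt M m p (k * h) := by
  filter_upwards [hp.eventually_image_grid] with h himage k
  induction k with
  | zero => simp only [Nat.cast_zero, zero_mul, stateAt_zero hM hm]; rfl
  | succ k ih =>
    refine (congrArg (moveTo · (p ((k + 1 : ℕ) * h))) ih).trans (stateAt_eq_moveTo ?_).symm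
    rw [himage, himage, ← Order.succ_eq_add_one, Order.Iic_succ, Set.image_insert_eq]

end RunningExtrema

/-! ### Exponentials of rate matrices -/

section TransitionMatrix

open scoped Matrix.Norms.Operator

variable {n : Type*} [Fintype n] [DecidableEq n] {A : Matrix n n ℝ}

theorem exp_apply_nonneg (hA : ∀ i j, 0 ≤ A i j) (i j : n) : 0 ≤ NormedSpace.exp A i j := by
  have hsum := (NormedSpace.exp_series_hasSum_exp' (𝕂 := ℝ) A).map (Matrix.entryAddMonoidHom ℝ i j)
    (continuous_id.matrix_elem i j)
  exact hsum.nonneg fun k => mul_nonneg (by positivity) (Matrix.pow_apply_nonneg hA k i j)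

theorem exp_apply_nonneg_of_offDiag (hA : ∀ i j, j ≠ i → 0 ≤ A i j) (i j : n) :
    0 ≤ NormedSpace.exp A i j := by
  obtain ⟨c, hc⟩ : ∃ c : ℝ, ∀ k, -c ≤ A k k :=
    ⟨∑ k, |A k k|, fun k => neg_le.1 <| (neg_le_abs _).trans <|
      Finset.single_le_sum (f := fun k => |A k k|) (fun _ _ => abs_nonneg _) (Finset.mem_univ k)⟩
  have hshift : 0 ≤ NormedSpace.exp (A + c • 1) i j := exp_apply_nonneg (fun k l => by
    rcases eq_or_ne l k with rfl | hlk
    · simpa [add_comm, neg_le_iff_add_nonneg] using hc l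
    · simpa [Matrix.one_apply_ne' hlk] using hA k l hlk) i j
  have hexp : NormedSpace.exp A = Real.exp (-c) • NormedSpace.exp (A + c • 1) := by
    have hone : NormedSpace.exp ((-c) • (1 : Matrix n n ℝ)) = Real.exp (-c) • 1 := by
      rw [← Algebra.algebraMap_eq_smul_one, ← Algebra.algebraMap_eq_smul_one, Real.exp_eq_exp_ℝ]
      exact (NormedSpace.algebraMap_exp_comm (𝔸 := Matrix n n ℝ) (-c)).symm
    calc NormedSpace.exp A = NormedSpace.exp ((-c) • (1 : Matrix n n ℝ) + (A + c • 1)) := by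
          rw [neg_smul]; congr 1; abel
      _ = Real.exp (-c) • NormedSpace.exp (A + c • 1) := by
          rw [Matrix.exp_add_of_commute _ _ ((Commute.one_left _).smul_left _), hone,
            smul_mul_assoc, one_mul]
  rw [hexp]
  exact mul_nonneg (Real.exp_pos _).le hshift

theorem hasDerivAt_cexp_mul_exp_smul (q : ℂ) (A : Matrix n n ℝ) (i j : n) :
    HasDerivAt (fun u : ℝ => Complex.exp (-q * u) * (NormedSpace.exp (u • A) i j : ℂ))
      ((A i j : ℂ) - q * (1 : Matrix n n ℂ) i j) 0 := by
  have hcexp : HasDerivAt (fun u : ℝ => Complex.exp (-q * u)) (-q) 0 := by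
    simpa using ((Complex.ofRealCLM.hasDerivAt (x := 0)).const_mul (-q)).cexp
  have hexp : HasDerivAt (fun u : ℝ => NormedSpace.exp (u • A)) A 0 := by
    have h := hasDerivAt_exp_smul_const A (0 : ℝ)
    rwa [zero_smul, NormedSpace.exp_zero, one_mul] at h
  have hentry : HasDerivAt (fun u : ℝ => (NormedSpace.exp (u • A) i j : ℂ)) (A i j) 0 :=
    (hasDerivAt_pi.1 (hasDerivAt_pi.1 hexp i) j).ofReal_comp
  refine (hcexp.mul hentry).congr_deriv ?_
  rcases eq_or_ne i j with rfl | hij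
  · simp [sub_eq_neg_add]
  · simp [hij]

end TransitionMatrix

theorem tendsto_slope_nnreal {f : ℝ → ℂ} {f' : ℂ} (hf : HasDerivAt f f' 0) :
    Tendsto (fun h : ℝ≥0 => (f h - f 0) / h) (𝓝[>] 0) (𝓝 f') := by
  have hcoe : Tendsto (fun h : ℝ≥0 => (h : ℝ)) (𝓝[>] 0) (𝓝[≠] 0) := by
    refine tendsto_nhdsWithin_iff.2
      ⟨(NNReal.continuous_coe.tendsto 0).mono_left nhdsWithin_le_nhds, ?_⟩
    filter_upwards [self_mem_nhdsWithin] with h hh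
    exact NNReal.coe_ne_zero.2 (ne_of_gt hh)
  refine (hf.tendsto_slope_zero.comp hcoe).congr fun h => ?_
  simp [div_eq_inv_mul]

/-! ### The chain along a grid -/

theorem measure_ext_of_cylinder {α : Type*} [Countable α] [MeasurableSpace α]
    [MeasurableSingletonClass α] {ν ν' : Measure (ℕ → α)} [IsFiniteMeasure ν]
    (h : ∀ (n : ℕ) (z : ℕ → α), ν {ξ | ∀ i ≤ n, ξ i = z i} = ν' {ξ | ∀ i ≤ n, ξ i = z i}) :
    ν = ν' := by
  have map_frestrictLe (n : ℕ) :
      ν'.map (Preorder.frestrictLe n) = ν.map (Preorder.frestrictLe n) := by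
    refine Measure.ext_of_singleton fun y => ?_
    have preimage_eq : Preorder.frestrictLe (π := fun _ => α) n ⁻¹' {y} =
        {ξ : ℕ → α | ∀ i ≤ n, ξ i = y ⟨min i n, Finset.mem_Iic.2 (min_le_right i n)⟩} := by
      ext ξ
      simp only [Set.mem_preimage, Set.mem_singleton_iff, funext_iff, Subtype.forall,
        Finset.mem_Iic, Preorder.frestrictLe_apply]
      refine forall₂_congr fun i hi => ?_
      simp only [min_eq_left hi]
    rw [Measure.map_apply (by fun_prop) (measurableSet_singleton y),
      Measure.map_apply (by fun_prop) (measurableSet_singleton y), preimage_eq, h]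
  have projective : IsProjectiveMeasureFamily fun I : Finset ℕ => ν.map I.restrict :=
    ProbabilityTheory.isProjectiveMeasureFamily_map_restrict (X := fun n (ξ : ℕ → α) => ξ n)
      fun n => (measurable_pi_apply n).aemeasurable
  have limit : IsProjectiveLimit ν fun I : Finset ℕ => ν.map I.restrict := fun I => rfl
  have limit' : IsProjectiveLimit ν' fun I : Finset ℕ => ν.map I.restrict :=
    (isProjectiveLimit_nat_iff projective ν').2 map_frestrictLe
  exact limit.unique limit'

section Chain

variable {Ω : Type*} [MeasurableSpace Ω] {S : Finset ℝ} {G : Matrix S S ℝ} {μ : S → Measure Ω}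
  {Y : ℝ≥0 → Ω → S}

theorem IsRateMatrix.exp_smul_apply_nonneg (hG : IsRateMatrix G) (s : ℝ≥0) (x z : S) :
    0 ≤ NormedSpace.exp ((s : ℝ) • G) x z :=
  exp_apply_nonneg_of_offDiag (fun i j hij => mul_nonneg s.2 (hG.offDiag_nonneg i j hij)) x z

theorem IsCTMC.ae_zero_eq (hY : IsCTMC G μ Y) (x : S) : ∀ᵐ ω ∂(μ x), Y 0 ω = x := by
  have := hY.prob x
  have hfdd := hY.fdd x 0 (fun _ => 0) (fun _ => x) monotone_const rfl rfl
  simp only [Finset.range_zero, Finset.prod_empty, ENNReal.ofReal_one, nonpos_iff_eq_zero,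
    forall_eq] at hfdd
  exact (prob_compl_eq_zero_iff (hY.measurable 0 (measurableSet_singleton x))).2 hfdd

theorem IsCTMC.measurable_path (hY : IsCTMC G μ Y) (t : ℕ → ℝ≥0) :
    Measurable fun ω k => Y (t k) ω :=
  measurable_pi_lambda _ fun _ => hY.measurable _

theorem IsCTMC.cylinder_shift (hG : IsRateMatrix G) (hY : IsCTMC G μ Y) (x : S) (s : ℝ≥0)
    {t : ℕ → ℝ≥0} (ht : Monotone t) (ht0 : t 0 = 0) (n : ℕ) (z : ℕ → S) :
    μ x {ω | ∀ i ≤ n, Y (s + t i) ω = z i} =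
      ENNReal.ofReal (NormedSpace.exp ((s : ℝ) • G) x (z 0)) *
        μ (z 0) {ω | ∀ i ≤ n, Y (t i) ω = z i} := by
  let t' : ℕ → ℝ≥0 := fun | 0 => 0 | i + 1 => s + t i
  let z' : ℕ → S := fun | 0 => x | i + 1 => z i
  have ht' : Monotone t' := monotone_nat_of_le_succ fun
    | 0 => zero_le
    | i + 1 => add_le_add_right (ht i.le_succ) s
  have hcylinder : {ω | ∀ i ≤ n, Y (s + t i) ω = z i} =ᵐ[μ x]
      {ω | ∀ i ≤ n + 1, Y (t' i) ω = z' i} := by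
    filter_upwards [hY.ae_zero_eq x] with ω hω
    refine propext ⟨fun h i hi => ?_, fun h i hi => h (i + 1) (Nat.succ_le_succ hi)⟩
    cases i with
    | zero => exact hω
    | succ i => exact h i (Nat.le_of_succ_le_succ hi)
  rw [measure_congr hcylinder, hY.fdd x (n + 1) t' z' ht' rfl rfl, hY.fdd (z 0) n t z ht ht0 rfl,
    ← ENNReal.ofReal_mul (hG.exp_smul_apply_nonneg s x (z 0)), Finset.prod_range_succ', mul_comm]
  simp [t', z', ht0]

theorem IsCTMC.map_shift (hG : IsRateMatrix G) (hY : IsCTMC G μ Y) (x : S) (s : ℝ≥0)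
    {t : ℕ → ℝ≥0} (ht : Monotone t) (ht0 : t 0 = 0) :
    (μ x).map (fun ω k => Y (s + t k) ω) =
      ∑ z, ENNReal.ofReal (NormedSpace.exp ((s : ℝ) • G) x z) •
        (μ z).map (fun ω k => Y (t k) ω) := by
  have := hY.prob x
  refine measure_ext_of_cylinder fun n z => ?_
  have hcyl : MeasurableSet {ξ : ℕ → S | ∀ i ≤ n, ξ i = z i} := by
    simp only [Set.ofPred_forall]
    exact .iInter fun i => .iInter fun _ =>
      (measurableSet_singleton (z i)).preimage (measurable_pi_apply i)
  have null_of_ne (w : S) (hw : w ≠ z 0) : μ w {ω | ∀ i ≤ n, Y (t i) ω = z i} = 0 := by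
    refine measure_mono_null (t := {ω | ¬ Y 0 ω = w}) (fun ω hω h0 => hw ?_)
      (ae_iff.1 (hY.ae_zero_eq w))
    rw [← h0, ← hω 0 n.zero_le, ht0]
  simp only [Measure.finsetSum_apply, Measure.smul_apply, smul_eq_mul,
    Measure.map_apply (hY.measurable_path _) hcyl, Set.preimage_ofPred_eq]
  rw [hY.cylinder_shift hG x s ht ht0, Finset.sum_eq_single (z 0)]
  · exact fun w _ hw => by rw [null_of_ne w hw, mul_zero]
  · simp

theorem IsCTMC.integral_shift (hG : IsRateMatrix G) (hY : IsCTMC G μ Y) (x : S) (s : ℝ≥0)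
    {t : ℕ → ℝ≥0} (ht : Monotone t) (ht0 : t 0 = 0) {F : (ℕ → S) → ℂ} (hF : Measurable F) {C : ℝ}
    (hC : ∀ ξ, ‖F ξ‖ ≤ C) :
    ∫ ω, F (fun k => Y (s + t k) ω) ∂(μ x) =
      ∑ z, (NormedSpace.exp ((s : ℝ) • G) x z : ℂ) * ∫ ω, F (fun k => Y (t k) ω) ∂(μ z) := by
  have integral_map (y : S) (t : ℕ → ℝ≥0) :
      ∫ ξ, F ξ ∂((μ y).map fun ω k => Y (t k) ω) = ∫ ω, F (fun k => Y (t k) ω) ∂(μ y) :=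
    MeasureTheory.integral_map (hY.measurable_path t).aemeasurable hF.aestronglyMeasurable
  have integrable (y : S) : Integrable F ((μ y).map fun ω k => Y (t k) ω) := by
    have := hY.prob y
    exact .of_bound hF.aestronglyMeasurable C (.of_forall hC)
  rw [← integral_map, hY.map_shift hG x s ht ht0, integral_finsetSum_measure
    fun z _ => (integrable z).smul_measure ENNReal.ofReal_ne_top]
  refine Finset.sum_congr rfl fun z _ => ?_
  rw [integral_smul_measure, integral_map, ENNReal.toReal_ofReal (hG.exp_smul_apply_nonneg s x z),
    Complex.real_smul]

variable {E : Type*} {D : Set E} {φ : E → ℂ} {γ : ℂ} {step : E → S → E}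

/-- Expected payoff `φ`, discounted by `γ` per time step, at the first entrance into `D` of the
states reached from `e` along `Y h, Y (2 h), …`, where `Y` starts in `x`. -/
noncomputable def gridValue (μ : S → Measure Ω) (Y : ℝ≥0 → Ω → S) (step : E → S → E) (D : Set E)
    (φ : E → ℂ) (γ : ℂ) (h : ℝ≥0) (x : S) (e : E) : ℂ :=
  ∫ ω, entrancePayoff D (fun k e => γ ^ k * φ e)
    (orbit step e fun k => Y ((k + 1 : ℕ) * h) ω) ∂(μ x)

theorem norm_pow_mul_le (hγ : ‖γ‖ ≤ 1) {C : ℝ} (hC : ∀ e, ‖φ e‖ ≤ C) (k : ℕ) (e : E) :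
    ‖γ ^ k * φ e‖ ≤ C := by
  rw [norm_mul, norm_pow]
  exact (mul_le_of_le_one_left (norm_nonneg _) (pow_le_one₀ (norm_nonneg _) hγ)).trans (hC e)

theorem measurable_orbit {α : Type*} [MeasurableSpace α] [Countable α] [DiscreteMeasurableSpace α]
    [MeasurableSpace E] [Countable E] [DiscreteMeasurableSpace E] (step : E → α → E)
    {e : Ω → E} {ξ : Ω → ℕ → α} (he : Measurable e) (hξ : Measurable ξ) (k : ℕ) :
    Measurable fun ω => orbit step (e ω) (ξ ω) k := by
  induction k with
  | zero => exact he
  | succ k ih =>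
    exact (Measurable.of_discrete (f := Function.uncurry step)).comp
      (ih.prodMk ((measurable_pi_apply k).comp hξ))

theorem IsCTMC.gridValue_of_notMem [MeasurableSpace E] [Countable E] [DiscreteMeasurableSpace E]
    (hG : IsRateMatrix G) (hY : IsCTMC G μ Y) (hγ : ‖γ‖ ≤ 1) {C : ℝ} (hC : ∀ e, ‖φ e‖ ≤ C)
    (h : ℝ≥0) (x : S) {e : E} (he : e ∉ D) :
    gridValue μ Y step D φ γ h x e =
      γ * ∑ z, (NormedSpace.exp ((h : ℝ) • G) x z : ℂ) *
        gridValue μ Y step D φ γ h z (step e z) := by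
  let F (ξ : ℕ → S) : ℂ := entrancePayoff D (fun k e => γ ^ k * φ e)
    (orbit step (step e (ξ 0)) fun k => ξ (k + 1))
  have hF : Measurable F := measurable_entrancePayoff D _ fun k =>
    measurable_orbit step (Measurable.of_discrete.comp (measurable_pi_apply 0))
      (measurable_pi_lambda _ fun j => measurable_pi_apply (j + 1)) k
  have hFC (ξ : ℕ → S) : ‖F ξ‖ ≤ C :=
    norm_entrancePayoff_le ((norm_nonneg _).trans (hC e)) (norm_pow_mul_le hγ hC)
  have first_step (ω : Ω) :
      entrancePayoff D (fun k e => γ ^ k * φ e) (orbit step e fun k => Y ((k + 1 : ℕ) * h) ω) =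
        γ * F fun k => Y (h + k * h) ω := by
    have htime (k : ℕ) : h + k * h = (k + 1 : ℕ) * h := by push_cast; ring
    rw [entrancePayoff_succ he]
    simp only [F, htime, orbit_succ', pow_succ', mul_assoc, entrancePayoff_const_mul]
  have hgrid : Monotone fun k : ℕ => (k : ℝ≥0) * h := fun i j hij =>
    mul_le_mul_left (Nat.cast_le.2 hij) h
  simp only [gridValue, first_step]
  rw [integral_const_mul, hY.integral_shift hG x h hgrid (by simp) hF hFC]
  congr 1
  refine Finset.sum_congr rfl fun z _ => congrArg _ (integral_congr_ae ?_)
  filter_upwards [hY.ae_zero_eq z] with ω hω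
  simp only [F, Nat.cast_zero, zero_mul, hω]

end Chain

/-! ### Harmonicity of entrance values -/

section Harmonic

variable {Ω : Type*} [MeasurableSpace Ω] {S : Finset ℝ} {G : Matrix S S ℝ} {μ : S → Measure Ω}
  {Y : ℝ≥0 → Ω → S} {D : Set (S × S × S)} {φ : S × S × S → ℂ} {q : ℂ} {e : S × S × S}

/-- Expected payoff `φ`, discounted at rate `q`, at the first entrance of the triple
(position, running maximum, running minimum) into `D`, starting from the triple `e`. -/
noncomputable def entranceValue (μ : S → Measure Ω) (Y : ℝ≥0 → Ω → S) (D : Set (S × S × S))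
    (φ : S × S × S → ℂ) (q : ℂ) (e : S × S × S) : ℂ :=
  ∫ ω, entrancePayoff D (fun (t : ℝ≥0) e => Complex.exp (-q * t) * φ e)
    (stateAt e.2.1 e.2.2 fun t => Y t ω) ∂(μ e.1)

theorem IsCTMC.rightConstant_path (hY : IsCTMC G μ Y) (ω : Ω) : RightConstant fun t => Y t ω :=
  rightConstant_of_continuousWithinAt (hY.rightCont ω)

theorem IsCTMC.entranceValue_of_mem (hY : IsCTMC G μ Y) (hmax : e.1 ≤ e.2.1) (hmin : e.2.2 ≤ e.1)
    (he : e ∈ D) : entranceValue μ Y D φ q e = φ e := by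
  have := hY.prob e.1
  have hpayoff : ∀ᵐ ω ∂(μ e.1), entrancePayoff D (fun (t : ℝ≥0) e => Complex.exp (-q * t) * φ e)
      (stateAt e.2.1 e.2.2 fun t => Y t ω) = φ e := by
    filter_upwards [hY.ae_zero_eq e.1] with ω hω
    have hstart : stateAt e.2.1 e.2.2 (fun t => Y t ω) 0 = e := by
      rw [stateAt_zero (hω.symm ▸ hmax) (hω.symm ▸ hmin), hω]
    have hleast : IsLeast {t | stateAt e.2.1 e.2.2 (fun t => Y t ω) t ∈ D} 0 :=
      ⟨show stateAt _ _ _ 0 ∈ D from hstart.symm ▸ he, fun _ _ => zero_le⟩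
    simp [entrancePayoff_of_isLeast hleast, hstart]
  rw [entranceValue, integral_congr_ae hpayoff, integral_const, probReal_univ, one_smul]

theorem norm_exp_neg_mul_le_one (hq : 0 ≤ q.re) (h : ℝ≥0) : ‖Complex.exp (-q * h)‖ ≤ 1 := by
  rw [Complex.norm_exp, Real.exp_le_one_iff]
  simpa using mul_nonneg hq h.2

theorem IsCTMC.tendsto_gridValue (hY : IsCTMC G μ Y) (hq : 0 ≤ q.re) (hmax : e.1 ≤ e.2.1)
    (hmin : e.2.2 ≤ e.1) :
    Tendsto (fun h : ℝ≥0 => gridValue μ Y moveTo D φ (Complex.exp (-q * h)) h e.1 e) (𝓝[>] 0)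
      (𝓝 (entranceValue μ Y D φ q e)) := by
  have := hY.prob e.1
  have hφ (e : S × S × S) : ‖φ e‖ ≤ ∑ e, ‖φ e‖ :=
    Finset.single_le_sum (f := fun e => ‖φ e‖) (fun _ _ => norm_nonneg _) (Finset.mem_univ e)
  refine tendsto_integral_filter_of_dominated_convergence (fun _ => ∑ e, ‖φ e‖)
    (.of_forall fun h => ?_) (.of_forall fun h => .of_forall fun ω => ?_) (integrable_const _) ?_
  · exact (measurable_entrancePayoff D _
      (measurable_orbit moveTo measurable_const (hY.measurable_path _))).aestronglyMeasurable
  · exact norm_entrancePayoff_le (Finset.sum_nonneg fun _ _ => norm_nonneg _)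
      (norm_pow_mul_le (norm_exp_neg_mul_le_one hq h) hφ)
  · filter_upwards [hY.ae_zero_eq e.1] with ω hω
    have hpath := hY.rightConstant_path ω
    refine ((hpath.rightConstant_stateAt e.2.1 e.2.2).tendsto_entrancePayoff_grid
      (fun e => by fun_prop)).congr' ?_
    filter_upwards [hpath.eventually_orbit_eq_stateAt (M := e.2.1) (m := e.2.2)
      (hω.symm ▸ hmax) (hω.symm ▸ hmin)] with h horbit
    rw [hω] at horbit
    simp only [← horbit, ← Complex.exp_nat_mul]
    congr 1
    funext k e
    push_cast
    ring_nf

/-- `u` satisfies the equation `(q - G) u = 0` on `I`, for a chain with rate matrix `G` that drives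
a state `e`: its position in state `e` is `pos e`, and when it jumps to `z` the state becomes
`step e z`. -/
def QHarmonicOn {E : Type*} (G : Matrix S S ℝ) (q : ℂ) (pos : E → S) (step : E → S → E)
    (I : Set E) (u : E → ℂ) : Prop :=
  ∀ e ∈ I, q * u e = ∑ z, (G (pos e) z : ℂ) * u (step e z)

theorem IsCTMC.qHarmonicOn_entranceValue (hG : IsRateMatrix G) (hY : IsCTMC G μ Y)
    (hq : 0 ≤ q.re) (D : Set (S × S × S)) (φ : S × S × S → ℂ) :
    QHarmonicOn G q Prod.fst moveTo {e | e.2.2 ≤ e.1 ∧ e.1 ≤ e.2.1 ∧ e ∉ D}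
      (entranceValue μ Y D φ q) := by
  rintro e ⟨hmin, hmax, he⟩
  have hφ (e : S × S × S) : ‖φ e‖ ≤ ∑ e, ‖φ e‖ :=
    Finset.single_le_sum (f := fun e => ‖φ e‖) (fun _ _ => norm_nonneg _) (Finset.mem_univ e)
  let V (h : ℝ≥0) (z : S) : ℂ :=
    gridValue μ Y moveTo D φ (Complex.exp (-q * h)) h z (moveTo e z)
  let P (z : S) (u : ℝ) : ℂ := Complex.exp (-q * u) * (NormedSpace.exp (u • G) e.1 z : ℂ)
  have bellman (h : ℝ≥0) : ∑ z, (P z h - P z 0) / h * V h z = 0 := by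
    have hP0 : ∑ z, P z 0 * V h z = V h e.1 := by
      rw [Finset.sum_eq_single e.1 (fun z _ hz => by simp [P, hz.symm]) (by simp)]
      simp [P]
    have hPh : ∑ z, P z h * V h z = V h e.1 := by
      simp only [P, V, moveTo_self hmax hmin, mul_assoc]
      rw [hY.gridValue_of_notMem hG (norm_exp_neg_mul_le_one hq h) hφ h e.1 he, Finset.mul_sum]
    simp only [div_mul_eq_mul_div, sub_mul, ← Finset.sum_div, Finset.sum_sub_distrib, hP0, hPh,
      sub_self, zero_div]
  have limit : Tendsto (fun h : ℝ≥0 => ∑ z, (P z h - P z 0) / h * V h z) (𝓝[>] 0)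
      (𝓝 (∑ z, ((G e.1 z : ℂ) - q * (1 : Matrix S S ℂ) e.1 z) *
        entranceValue μ Y D φ q (moveTo e z))) :=
    tendsto_finsetSum _ fun z _ =>
      (tendsto_slope_nnreal (hasDerivAt_cexp_mul_exp_smul q G e.1 z)).mul
        (hY.tendsto_gridValue hq le_sup_right inf_le_right)
  simp only [bellman] at limit
  have hzero := tendsto_nhds_unique limit tendsto_const_nhds
  have hdiag : ∑ z, q * (1 : Matrix S S ℂ) e.1 z * entranceValue μ Y D φ q (moveTo e z) =
      q * entranceValue μ Y D φ q e := by
    simp [Matrix.one_apply, moveTo_self hmax hmin]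
  simp only [sub_mul, Finset.sum_sub_distrib, hdiag] at hzero
  exact (sub_eq_zero.1 hzero).symm

end Harmonic

/-! ### The maximum principle -/

section MaximumPrinciple

variable {S : Finset ℝ} {G : Matrix S S ℝ} {q : ℂ} {E : Type*} {pos : E → S} {step : E → S → E}
  {I : Set E} {u v : E → ℂ}

theorem QHarmonicOn.add (hu : QHarmonicOn G q pos step I u) (hv : QHarmonicOn G q pos step I v) :
    QHarmonicOn G q pos step I fun e => u e + v e := fun e he => by
  simp only [mul_add, hu e he, hv e he, Finset.sum_add_distrib]

theorem QHarmonicOn.sub (hu : QHarmonicOn G q pos step I u) (hv : QHarmonicOn G q pos step I v) :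
    QHarmonicOn G q pos step I fun e => u e - v e := fun e he => by
  simp only [mul_sub, hu e he, hv e he, Finset.sum_sub_distrib]

theorem QHarmonicOn.mul_const (hu : QHarmonicOn G q pos step I u) (c : ℂ) :
    QHarmonicOn G q pos step I fun e => u e * c := fun e he => by
  simp only [← mul_assoc, hu e he, Finset.sum_mul]

theorem QHarmonicOn.sum {ι : Type*} {s : Finset ι} {u : ι → E → ℂ}
    (hu : ∀ i ∈ s, QHarmonicOn G q pos step I (u i)) :
    QHarmonicOn G q pos step I fun e => ∑ i ∈ s, u i e := fun e he => by
  rw [Finset.mul_sum, Finset.sum_congr rfl fun i hi => hu i hi e he, Finset.sum_comm]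
  simp only [Finset.mul_sum]

theorem IsRateMatrix.eq_zero_of_forall_norm_le (hG : IsRateMatrix G) (hq : 0 < q.re) {x : S}
    {f : S → ℂ} (hf : q * f x = ∑ z, (G x z : ℂ) * f z) (hmax : ∀ z, ‖f z‖ ≤ ‖f x‖) :
    f x = 0 := by
  let c : ℝ := ∑ z ∈ Finset.univ.erase x, G x z
  have offDiag : (q + c) * f x = ∑ z ∈ Finset.univ.erase x, (G x z : ℂ) * f z := by
    rw [add_mul, hf, ← Finset.add_sum_erase _ _ (Finset.mem_univ x), hG.diag_eq]
    simp only [c]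
    push_cast
    ring
  have hle : (q.re + c) * ‖f x‖ ≤ c * ‖f x‖ :=
    calc (q.re + c) * ‖f x‖ ≤ ‖q + c‖ * ‖f x‖ := by
          gcongr
          simpa using Complex.re_le_norm (q + c)
      _ = ‖∑ z ∈ Finset.univ.erase x, (G x z : ℂ) * f z‖ := by rw [← norm_mul, offDiag]
      _ ≤ ∑ z ∈ Finset.univ.erase x, G x z * ‖f x‖ := norm_sum_le_of_le _ fun z hz => by
          have hz0 := hG.offDiag_nonneg x z (Finset.ne_of_mem_erase hz)
          rw [norm_mul, Complex.norm_real, Real.norm_of_nonneg hz0]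
          exact mul_le_mul_of_nonneg_left (hmax z) hz0
      _ = c * ‖f x‖ := (Finset.sum_mul _ _ _).symm
  exact norm_le_zero_iff.1 (nonpos_of_mul_nonpos_right (by linarith) hq)

theorem IsRateMatrix.eqOn_of_qHarmonicOn (hG : IsRateMatrix G) (hq : 0 < q.re) (hI : I.Finite)
    (hstep : ∀ e ∈ I, step e (pos e) = e) (hu : QHarmonicOn G q pos step I u)
    (hv : QHarmonicOn G q pos step I v)
    (hboundary : ∀ e ∈ I, ∀ z, step e z ∉ I → u (step e z) = v (step e z)) :
    Set.EqOn u v I := by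
  intro e₀ he₀
  obtain ⟨e, he, hmax⟩ := Set.exists_max_image I (fun e => ‖u e - v e‖) hI ⟨e₀, he₀⟩
  have hzero : u (step e (pos e)) - v (step e (pos e)) = 0 := by
    refine hG.eq_zero_of_forall_norm_le hq (f := fun z => u (step e z) - v (step e z)) ?_
      fun z => ?_
    · simpa only [hstep e he] using hu.sub hv e he
    · rw [hstep e he]
      by_cases hz : step e z ∈ I
      · exact hmax _ hz
      · rw [hboundary e he z hz, sub_self, norm_zero]
        exact norm_nonneg _
  rw [hstep e he] at hzero
  have hnorm := hmax e₀ he₀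
  rw [hzero, norm_zero] at hnorm
  exact sub_eq_zero.1 (norm_le_zero_iff.1 hnorm)

end MaximumPrinciple

/-! ### First passage, drawdown and drawup -/

section Identification

variable {Ω : Type*} [MeasurableSpace Ω] {S : Finset ℝ} {G : Matrix S S ℝ} {μ : S → Measure Ω}
  {Y : ℝ≥0 → Ω → S} {q : ℂ}

theorem RightConstant.exitTime_eq_entranceTime {p : ℝ≥0 → S} (hp : RightConstant p) (U : Set ℝ)
    (M m : S) : exitTime U p = entranceTime {e | (e.1 : ℝ) ∉ U} (stateAt M m p) := by
  refine le_antisymm (le_iInf₂ fun t (ht : (p t : ℝ) ∉ U) => ?_)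
    (le_iInf₂ fun t ht => iInf₂_le t ht.2)
  refine ge_of_tendsto ((ENNReal.continuous_coe.tendsto t).mono_left
    (nhdsWithin_le_nhds (s := Set.Ioi t))) ?_
  filter_upwards [(hp t).filter_mono (nhdsWithin_mono t Set.Ioi_subset_Ici_self),
    self_mem_nhdsWithin] with u hpu htu
  exact iInf₂_le u ⟨pos_of_gt htu, hpu ▸ ht⟩

open Classical in
theorem IsCTMC.entranceValue_union (hY : IsCTMC G μ Y) (A B : Set (S × S × S))
    (φ : S × S × S → ℂ) (q : ℂ) (e : S × S × S) :
    entranceValue μ Y (A ∪ B) (Bᶜ.indicator φ) q e =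
      ∫ ω, (let X := stateAt e.2.1 e.2.2 fun t => Y t ω
        let T := entranceTime A X
        if T < entranceTime B X then Complex.exp (-q * (T.toReal : ℂ)) * φ (X T.toNNReal)
        else 0) ∂(μ e.1) := by
  have payoff_eq : (fun (t : ℝ≥0) e => Complex.exp (-q * t) * Bᶜ.indicator φ e) =
      fun t : ℝ≥0 => Bᶜ.indicator fun e => Complex.exp (-q * t) * φ e := by
    funext t e
    rw [Set.indicator_mul_right]
  rw [entranceValue, payoff_eq]
  exact integral_congr_ae (.of_forall fun ω =>
    ((hY.rightConstant_path ω).rightConstant_stateAt e.2.1 e.2.2).entrancePayoff_union A B _)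

theorem IsCTMC.exitP_eq_entranceValue (hY : IsCTMC G μ Y) (U : Set ℝ) (f : S → ℂ)
    (e : S × S × S) :
    exitP μ Y U q e.1 f =
      entranceValue μ Y {e | (e.1 : ℝ) ∉ U} (fun e => f e.1) q e := by
  classical
  have h := hY.entranceValue_union {e | (e.1 : ℝ) ∉ U} ∅ (fun e => f e.1) q e
  simp only [Set.union_empty, Set.compl_empty, Set.indicator_univ,
    entranceTime_of_forall_notMem fun _ => Set.notMem_empty _] at h
  simp only [h, exitP, (hY.rightConstant_path _).exitTime_eq_entranceTime U e.2.1 e.2.2]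
  rfl

theorem IsCTMC.exitP_generator (hG : IsRateMatrix G) (hY : IsCTMC G μ Y) (hq : 0 ≤ q.re)
    {U : Set ℝ} (f : S → ℂ) {x : S} (hx : (x : ℝ) ∈ U) :
    q * exitP μ Y U q x f = ∑ z, (G x z : ℂ) * exitP μ Y U q z f := by
  have h := hY.qHarmonicOn_entranceValue hG hq {e | (e.1 : ℝ) ∉ U} (fun e => f e.1) (x, x, x)
    ⟨le_rfl, le_rfl, not_not.2 hx⟩
  simp only [← hY.exitP_eq_entranceValue] at h
  exact h

theorem IsCTMC.exitP_of_notMem (hY : IsCTMC G μ Y) {U : Set ℝ} (f : S → ℂ) {x : S}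
    (hx : (x : ℝ) ∉ U) : exitP μ Y U q x f = f x :=
  (hY.exitP_eq_entranceValue U f (x, x, x)).trans (hY.entranceValue_of_mem le_rfl le_rfl hx)

theorem IsCTMC.upExitR_eq_entranceValue (hY : IsCTMC G μ Y) (ℓ r : ℝ) (g : S → S → ℂ)
    (e : S × S × S) :
    upExitR μ Y ℓ r q e.1 e.2.2 g =
      entranceValue μ Y ({e | (e.1 : ℝ) ∉ Set.Iic r} ∪ {e | (e.1 : ℝ) ∉ Set.Ioi ℓ})
        ({e | (e.1 : ℝ) ∉ Set.Ioi ℓ}ᶜ.indicator fun e => g e.1 e.2.2) q e := by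
  rw [hY.entranceValue_union]
  simp only [upExitR, (hY.rightConstant_path _).exitTime_eq_entranceTime _ e.2.1 e.2.2]
  rfl

theorem IsCTMC.upExitR_generator (hG : IsRateMatrix G) (hY : IsCTMC G μ Y) (hq : 0 ≤ q.re)
    {ℓ r : ℝ} (g : S → S → ℂ) {x y : S} (hyx : y ≤ x) (hx : (x : ℝ) ∈ Set.Ioc ℓ r) :
    q * upExitR μ Y ℓ r q x y g = ∑ z, (G x z : ℂ) * upExitR μ Y ℓ r q z (min y z) g := by
  have h := hY.qHarmonicOn_entranceValue hG hq
    ({e | (e.1 : ℝ) ∉ Set.Iic r} ∪ {e | (e.1 : ℝ) ∉ Set.Ioi ℓ})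
    ({e | (e.1 : ℝ) ∉ Set.Ioi ℓ}ᶜ.indicator fun e => g e.1 e.2.2) (x, x, y)
    ⟨hyx, le_rfl, by simpa [and_comm] using hx⟩
  simp only [← hY.upExitR_eq_entranceValue] at h
  exact h

theorem IsCTMC.upExitR_of_notMem (hY : IsCTMC G μ Y) {ℓ r : ℝ} (hlr : ℓ < r) (g : S → S → ℂ)
    {x y : S} (hyx : y ≤ x) (hx : (x : ℝ) ∉ Set.Ioc ℓ r) :
    upExitR μ Y ℓ r q x y g = g x y * (if r < (x : ℝ) then 1 else 0) := by
  have hexit : ¬ (x : ℝ) ≤ r ∨ ¬ ℓ < x := by rwa [← not_and_or, and_comm]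
  have hup : ℓ < x ↔ r < x := ⟨fun h => not_le.1 (hexit.resolve_right (not_not.2 h)), hlr.trans⟩
  rw [hY.upExitR_eq_entranceValue ℓ r g (x, x, y), hY.entranceValue_of_mem le_rfl hyx hexit]
  simp [Set.indicator_apply, hup]

/-- `E [e^{-q τ_a} 1{τ_a < τ̂_b} f(Y_{τ_a})]` with position, running maximum and running minimum
starting from the triple `e`. It extends `drawdownA`, where the maximum starts at the position. -/
noncomputable def drawdownValue (μ : S → Measure Ω) (Y : ℝ≥0 → Ω → S) (a b : ℝ) (f : S → ℂ) (q : ℂ)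
    (e : S × S × S) : ℂ :=
  entranceValue μ Y ({e | a ≤ (e.2.1 : ℝ) - e.1} ∪ {e | b ≤ (e.1 : ℝ) - e.2.2})
    ({e | b ≤ (e.1 : ℝ) - e.2.2}ᶜ.indicator fun e => f e.1) q e

variable {a b : ℝ} {e : S × S × S}

theorem IsCTMC.drawdownA_eq_drawdownValue (hY : IsCTMC G μ Y) (f : S → ℂ) (x y : S) :
    drawdownA μ Y a b f q x y = drawdownValue μ Y a b f q (x, x, y) :=
  (hY.entranceValue_union {e | a ≤ (e.2.1 : ℝ) - e.1} {e | b ≤ (e.1 : ℝ) - e.2.2}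
    (fun e => f e.1) q (x, x, y)).symm

theorem IsCTMC.drawdownValue_of_drawup (hY : IsCTMC G μ Y) (f : S → ℂ) (hmax : e.1 ≤ e.2.1)
    (hmin : e.2.2 ≤ e.1) (he : b ≤ (e.1 : ℝ) - e.2.2) : drawdownValue μ Y a b f q e = 0 :=
  (hY.entranceValue_of_mem hmax hmin (Or.inr he)).trans (Set.indicator_of_notMem (not_not.2 he) _)

theorem IsCTMC.drawdownValue_of_drawdown (hY : IsCTMC G μ Y) (f : S → ℂ) (hmax : e.1 ≤ e.2.1)
    (hmin : e.2.2 ≤ e.1) (hdown : a ≤ (e.2.1 : ℝ) - e.1) (hup : (e.1 : ℝ) - e.2.2 < b) :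
    drawdownValue μ Y a b f q e = f e.1 :=
  (hY.entranceValue_of_mem hmax hmin (Or.inl hdown)).trans (Set.indicator_of_mem hup.not_ge _)

theorem IsCTMC.qHarmonicOn_drawdownValue (hG : IsRateMatrix G) (hY : IsCTMC G μ Y)
    (hq : 0 ≤ q.re) (f : S → ℂ) :
    QHarmonicOn G q Prod.fst moveTo
      {e | e.2.2 ≤ e.1 ∧ e.1 ≤ e.2.1 ∧ (e.2.1 : ℝ) - e.1 < a ∧ (e.1 : ℝ) - e.2.2 < b}
      (drawdownValue μ Y a b f q) := fun e ⟨hmin, hmax, hdown, hup⟩ =>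
  hY.qHarmonicOn_entranceValue hG hq _ _ e
    ⟨hmin, hmax, not_or.2 ⟨hdown.not_ge, hup.not_ge⟩⟩

end Identification

section Recursion

variable {Ω : Type*} [MeasurableSpace Ω] {S : Finset ℝ} {G : Matrix S S ℝ} {μ : S → Measure Ω}
  {Y : ℝ≥0 → Ω → S} {q : ℂ} {a b ℓ r : ℝ}

/-- The right-hand side of the recursion for `drawdownA`, for the interval `(ℓ, r]` and the bound
`y` on the minimum at exit, as a function of the initial position `x` and minimum `m`. -/
noncomputable def exitDecomposition (μ : S → Measure Ω) (Y : ℝ≥0 → Ω → S) (a b ℓ r : ℝ)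
    (f : S → ℂ) (q : ℂ) (y x m : S) : ℂ :=
  exitP μ Y (Set.Ioc ℓ r) q x (fun s => if (s : ℝ) ≤ ℓ then f s else 0) +
    ∑ z ∈ Finset.univ.filter (fun z : S => (z : ℝ) ∈ Set.Ioo r ((y : ℝ) + b)),
      ∑ w ∈ Finset.univ.filter
          (fun w : S => (w : ℝ) ∈ Set.Ioc (max ℓ ((z : ℝ) - b)) (y : ℝ)),
        upExitR μ Y ℓ r q x m (fun s m => if s = z ∧ m = w then 1 else 0) *
          drawdownA μ Y a b f q z w

theorem IsCTMC.qHarmonicOn_exitDecomposition (hG : IsRateMatrix G) (hY : IsCTMC G μ Y)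
    (hq : 0 ≤ q.re) (f : S → ℂ) (y : S) :
    QHarmonicOn G q Prod.fst moveTo {e : S × S × S | e.2.2 ≤ e.1 ∧ (e.1 : ℝ) ∈ Set.Ioc ℓ r}
      fun e => exitDecomposition μ Y a b ℓ r f q y e.1 e.2.2 :=
  .add (fun _ he => hY.exitP_generator hG hq _ he.2) <| .sum fun _ _ => .sum fun _ _ =>
    .mul_const (fun _ he => hY.upExitR_generator hG hq _ he.1 he.2) _

theorem IsCTMC.exitDecomposition_of_le (hY : IsCTMC G μ Y) (hlr : ℓ < r) (f : S → ℂ) (y : S)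
    {x m : S} (hm : m ≤ x) (hx : (x : ℝ) ≤ ℓ) :
    exitDecomposition μ Y a b ℓ r f q y x m = f x := by
  have hnot : (x : ℝ) ∉ Set.Ioc ℓ r := fun h => hx.not_gt h.1
  simp [exitDecomposition, hY.exitP_of_notMem _ hnot, hY.upExitR_of_notMem hlr _ hm hnot, hx,
    (hx.trans hlr.le).not_gt]

theorem IsCTMC.exitDecomposition_of_lt (hY : IsCTMC G μ Y) (hlr : ℓ < r) (f : S → ℂ)
    {x m y : S} (hx : r < x) (hmx : m ≤ x) (hm : ℓ < m) (hmy : m ≤ y) :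
    exitDecomposition μ Y a b ℓ r f q y x m =
      if (x : ℝ) - m < b then drawdownA μ Y a b f q x m else 0 := by
  have hnot : (x : ℝ) ∉ Set.Ioc ℓ r := fun h => hx.not_ge h.2
  have hmy' : (m : ℝ) ≤ y := hmy
  simp only [exitDecomposition, hY.exitP_of_notMem _ hnot, hY.upExitR_of_notMem hlr _ hmx hnot,
    (hlr.trans hx).not_ge, if_false, zero_add, hx, if_true, mul_one, ite_and, ite_mul, one_mul,
    zero_mul, Finset.sum_ite_eq, Finset.sum_ite_irrel, Finset.sum_const_zero,
    Finset.mem_filter, Finset.mem_univ, true_and, Set.mem_Ioo, Set.mem_Ioc, max_lt_iff, hm, hmy']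
  rw [← ite_and]
  exact if_congr ⟨fun h => by linarith [h.2], fun h => ⟨by linarith, by linarith⟩⟩ rfl rfl

theorem IsCTMC.drawdownValue_eq_exitDecomposition_of_notMem (hY : IsCTMC G μ Y) (hab : a ≤ b)
    (f : S → ℂ) {x y z m : S} (hm : (x : ℝ) - a < m) (hmx : m ≤ x) (hmy : m ≤ y)
    (hz : (z : ℝ) ∉ Set.Ioc ((x : ℝ) - a) x) :
    drawdownValue μ Y a b f q (z, x ⊔ z, m ⊓ z) =
      exitDecomposition μ Y a b ((x : ℝ) - a) x f q y z (m ⊓ z) := by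
  have hlr : (x : ℝ) - a < x := hm.trans_le hmx
  rcases le_or_gt (z : ℝ) ((x : ℝ) - a) with hza | hza
  · have hzm : z ≤ m := hza.trans hm.le
    have hzx : z ≤ x := hzm.trans hmx
    rw [sup_eq_left.2 hzx, inf_eq_right.2 hzm, hY.exitDecomposition_of_le hlr f y le_rfl hza,
      hY.drawdownValue_of_drawdown f hzx le_rfl (by linarith) (by linarith)]
  · have hxz : x < z := not_le.1 fun hzx => hz ⟨hza, hzx⟩
    have hmz : m ≤ z := hmx.trans hxz.le
    rw [sup_eq_right.2 hxz.le, inf_eq_left.2 hmz,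
      hY.exitDecomposition_of_lt hlr f hxz hmz hm hmy]
    split_ifs with hup
    · exact (hY.drawdownA_eq_drawdownValue f z m).symm
    · exact hY.drawdownValue_of_drawup f le_rfl hmz (not_lt.1 hup)

theorem IsCTMC.drawdownA_eq_exitDecomposition (hG : IsRateMatrix G) (hY : IsCTMC G μ Y)
    (hq : 0 < q.re) (hab : a ≤ b) (f : S → ℂ) {x y : S}
    (hy : (y : ℝ) ∈ Set.Ioc ((x : ℝ) - a) (x : ℝ)) :
    drawdownA μ Y a b f q x y = exitDecomposition μ Y a b ((x : ℝ) - a) x f q y x y := by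
  have hlr : (x : ℝ) - a < x := hy.1.trans_le hy.2
  let I : Set (S × S × S) := {e | (e.1 : ℝ) ∈ Set.Ioc ((x : ℝ) - a) x ∧ (x : ℝ) - a < e.2.2 ∧
    e.2.2 ≤ e.1 ∧ e.2.2 ≤ y ∧ e.2.1 = x}
  -- Before `(x - a, x]` is left there is no drawdown and, as `a ≤ b`, no drawup.
  have hdown : QHarmonicOn G q Prod.fst moveTo I (drawdownValue μ Y a b f q) := by
    rintro e ⟨hpos, hmin, hle, -, hmax⟩
    refine hY.qHarmonicOn_drawdownValue hG hq.le f e ⟨hle, hmax ▸ hpos.2, ?_, ?_⟩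
    · rw [hmax]
      linarith [hpos.1]
    · linarith [hpos.2]
  have hexit : QHarmonicOn G q Prod.fst moveTo I fun e =>
      exitDecomposition μ Y a b ((x : ℝ) - a) x f q y e.1 e.2.2 := fun e ⟨hpos, _, hle, _⟩ =>
    hY.qHarmonicOn_exitDecomposition hG hq.le f y e ⟨hle, hpos⟩
  have hself : ∀ e ∈ I, moveTo e e.1 = e := fun e ⟨hpos, _, hle, _, hmax⟩ =>
    moveTo_self (hmax ▸ hpos.2) hle
  have heq := hG.eqOn_of_qHarmonicOn hq I.toFinite hself hdown hexit ?_
  · exact (hY.drawdownA_eq_drawdownValue f x y).trans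
      (heq (x := (x, x, y)) ⟨⟨hlr, le_rfl⟩, hy.1, hy.2, le_rfl, rfl⟩)
  rintro ⟨_, _, m⟩ ⟨hpos, hmin, hle, hmy, rfl⟩ z hz
  refine hY.drawdownValue_eq_exitDecomposition_of_notMem hab f hmin (hle.trans hpos.2) hmy
    fun hzU => hz ⟨hzU, ?_, inf_le_right, inf_le_left.trans hmy, sup_eq_left.2 hzU.2⟩
  rcases min_choice m z with h | h <;> simp only [moveTo, h, hmin, hzU.1]

end Recursion

end CTMC

theorem mainTheorem2 {Ω : Type*} [MeasurableSpace Ω] (S : Finset ℝ) (G : Matrix S S ℝ)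
    (hG : CTMC.IsRateMatrix G) (μ : S → MeasureTheory.Measure Ω) (Y : ℝ≥0 → Ω → S)
    (hY : CTMC.IsCTMC G μ Y) (q : ℂ) (hq : 0 < q.re) :
    (∀ (a b : ℝ), a ≤ b → ∀ (f : S → ℂ) (x y : S), (y : ℝ) ∈ Set.Ioc ((x : ℝ) - a) (x : ℝ) →
      CTMC.drawdownA μ Y a b f q x y =
        CTMC.exitP μ Y (Set.Ioc ((x : ℝ) - a) (x : ℝ)) q x
          (fun s => if (s : ℝ) ≤ (x : ℝ) - a then f s else 0) +
        ∑ z ∈ Finset.univ.filter (fun z : S => (z : ℝ) ∈ Set.Ioo (x : ℝ) ((y : ℝ) + b)),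
          ∑ w ∈ Finset.univ.filter
              (fun w : S => (w : ℝ) ∈ Set.Ioc (max ((x : ℝ) - a) ((z : ℝ) - b)) (y : ℝ)),
            CTMC.upExitR μ Y ((x : ℝ) - a) (x : ℝ) q x y
              (fun s m => if s = z ∧ m = w then 1 else 0) *
            CTMC.drawdownA μ Y a b f q z w) ∧
    (∀ (ℓ r : ℝ), ℓ < r → ∀ (g : S → S → ℂ) (x y : S), (y : ℝ) ≤ (x : ℝ) →
      ((x : ℝ) ∈ Set.Ioc ℓ r →
        q * CTMC.upExitR μ Y ℓ r q x y g -
          ∑ z : S, (G x z : ℂ) * CTMC.upExitR μ Y ℓ r q z (min y z) g = 0) ∧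
      ((x : ℝ) ∉ Set.Ioc ℓ r →
        CTMC.upExitR μ Y ℓ r q x y g = g x y * (if r < (x : ℝ) then 1 else 0))) :=
  ⟨fun _ _ hab f _ _ hy => hY.drawdownA_eq_exitDecomposition hG hq hab f hy,
    fun _ _ hlr g _ _ hyx => ⟨fun hx => sub_eq_zero.2 (hY.upExitR_generator hG hq.le g hyx hx),
      fun hx => hY.upExitR_of_notMem hlr g hyx hx⟩⟩
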